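/- Conventions. For $x\in\{0,1\}^k$ the weight of $x$ is its number of $1$'s. All structures considered here have a single $k$-ary relation. For $1\le t<k$ and $S\subseteq\{0,1\}^k$, let $t\text{-in-}k\cup\mathbf S$ be the structure on $\{0,1\}$ whose relation consists of all $k$-tuples of weight $t$ together with the tuples of $S$, and let $\mathbf{NAE}$ be the structure on $\{0,1\}$ whose relation consists of all $k$-tuples except $0^k$ and $1^k$. An instance is a structure $\mathbf X=(X;T)$ with $X$ a finite set and $\emptyset\ne T\subseteq X^k$; a homomorphism $\mathbf X\to\mathbf B$ is a map of the domains that, applied componentwise, sends tuples of the relation of $\mathbf X$ to tuples of the relation of $\mathbf B$. Let $\mathbf A=(A;R)$ be a finite structure and $\mathbf X=(X;T)$ an instance. Consider variables $v_{\vec x}(\vec a)$ for $\vec x\in T$, $\vec a\in R$, and $v_x(a)$ for $x\in X$, $a\in A$, and the equations $$\sum_{\vec a\in R}v_{\vec x}(\vec a)=1\quad(\vec x\in T),\qquad \sum_{a\in A}v_x(a)=1\quad(x\in X),$$ $$\sum_{\vec a\in R,\ a_j=a}v_{\vec x}(\vec a)=v_{x_j}(a)\quad(\vec x\in T,\ a\in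 A,\ 1\le j\le k).$$ $\mathrm{AIP}$ accepts $\mathbf X$ (over $\mathbf A$) if these equations have a solution in integers. $\mathrm{BLP}(\mathbf X,\mathbf A)$ is the polytope of real solutions with all variables in $[0,1]$. $\mathrm{BLP}+\mathrm{AIP}$ accepts $\mathbf X$ (over $\mathbf A$) if $\mathrm{BLP}(\mathbf X,\mathbf A)$ has a relative interior point $\lambda$ such that the equations have an integer solution $\tau$ in which every variable that is $0$ in $\lambda$ is $0$ in $\tau$ (this does not depend on the choice of $\lambda$). $\mathrm{AIP}$ (respectively $\mathrm{BLP}+\mathrm{AIP}$) solves $\mathrm{PCSP}(\mathbf A,\mathbf B)$ if every instance $\mathbf X$ that it accepts over $\mathbf A$ has a homomorphism to $\mathbf B$. Theorem. Let $k\ge 3$, let $1\le t<k$, and let $S$ be a nonempty set of tuples in $\{0,1\}^k\setminus\{0^k,1^k\}$, none of which has weight $t$. 1. If $t$ is odd, $k$ is even and every tuple of $S$ has odd weight, then $\mathrm{PCSP}(t\text{-in-}k\cup\mathbf S,\mathbf{NAE})$ is solved by $\mathrm{AIP}$. 2. In every other case $\mathrm{PCSP}(t\text{-in-}k\cup\mathbf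 S,\mathbf{NAE})$ is not solved by $\mathrm{BLP}+\mathrm{AIP}$. -/

import Mathlib

namespace PromiseCSP

/-- A relational structure with domain `D` over the signature with `p` relation symbols, the `i`-th
of arity `ar i`. (Finiteness of the domain and non-emptiness of the relations are imposed where
instances are quantified over.) -/
structure RelStr {p : ℕ} (ar : Fin p → ℕ) (D : Type) where
  rel : ∀ i : Fin p, Set (Fin (ar i) → D)

variable {p : ℕ} {ar : Fin p → ℕ} {V D E : Type}

/-- `h` is a homomorphism: applied componentwise, it maps related tuples to related tuples. -/
def IsHom (X : RelStr ar V) (B : RelStr ar E) (h : V → E) : Prop :=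
  ∀ i, ∀ x ∈ X.rel i, h ∘ x ∈ B.rel i

/-- There is a homomorphism from `X` to `B`. -/
def HomTo (X : RelStr ar V) (B : RelStr ar E) : Prop :=
  ∃ h : V → E, IsHom X B h

/-- Values in `K` for the variables of the relaxations of the instance `X` over the template
structure `A`. For `v : RelaxVars X A K`, the entry `v.1 i x a` is the variable of the `i`-th
relation, the tuple `x` of `X` and the tuple `a` of `A`. Both structures are understood to be
extended by one unary relation consisting of the whole domain, and `v.2 x a` is the variable of that
relation, the element `x` of `X` and the element `a` of `A`. -/
abbrev RelaxVars (X : RelStr ar V) (A : RelStr ar D) (K : Type) : Type :=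
  (∀ i, X.rel i → A.rel i → K) × (V → D → K)

open Classical in
/-- The equations common to the relaxations: the values attached to each tuple of the instance sum
to one, and their marginal at each coordinate is given by the variables of the full unary relation
(for the unary relation itself the latter equation is trivial). -/
def RelaxEqs [Fintype D] (X : RelStr ar V) (A : RelStr ar D) {K : Type} [CommRing K]
    (v : RelaxVars X A K) : Prop :=
  (∀ (i : Fin p) (x : X.rel i), ∑ a : A.rel i, v.1 i x a = 1) ∧
  (∀ x : V, ∑ a : D, v.2 x a = 1) ∧
  (∀ (i : Fin p) (x : X.rel i) (b : D) (j : Fin (ar i)),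
    ∑ a : A.rel i with a.1 j = b, v.1 i x a = v.2 (x.1 j) b)

/-- The feasible region of the basic linear programming relaxation. -/
def BLP [Fintype D] (X : RelStr ar V) (A : RelStr ar D) : Set (RelaxVars X A ℝ) :=
  {v | (∀ i x a, 0 ≤ v.1 i x a ∧ v.1 i x a ≤ 1) ∧ (∀ x a, 0 ≤ v.2 x a ∧ v.2 x a ≤ 1) ∧
    RelaxEqs X A v}

/-- The basic affine integer programming relaxation is feasible. -/
def AIPAccepts [Fintype D] (X : RelStr ar V) (A : RelStr ar D) : Prop :=
  ∃ τ : RelaxVars X A ℤ, RelaxEqs X A τ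

/-- The BLP+AIP algorithm accepts: there is a relative interior point `l` of the BLP polytope such
that the affine program refined by `τ = 0` wherever `l = 0` is feasible. (All relative interior
points vanish at the same variables, so the choice of `l` is immaterial.) -/
def BLPAIPAccepts [Fintype D] (X : RelStr ar V) (A : RelStr ar D) : Prop :=
  ∃ l ∈ intrinsicInterior ℝ (BLP X A), ∃ τ : RelaxVars X A ℤ, RelaxEqs X A τ ∧
    (∀ i x a, l.1 i x a = 0 → τ.1 i x a = 0) ∧ (∀ x a, l.2 x a = 0 → τ.2 x a = 0)

/-- AIP solves `PCSP(A, B)`: every instance that it accepts has a homomorphism to `B`. -/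
def AIPSolves [Fintype D] (A : RelStr ar D) (B : RelStr ar E) : Prop :=
  ∀ (V : Type) [Finite V] (X : RelStr ar V), (∀ i, (X.rel i).Nonempty) →
    AIPAccepts X A → HomTo X B

/-- BLP+AIP solves `PCSP(A, B)`: every instance that it accepts has a homomorphism to `B`. -/
def BLPAIPSolves [Fintype D] (A : RelStr ar D) (B : RelStr ar E) : Prop :=
  ∀ (V : Type) [Finite V] (X : RelStr ar V), (∀ i, (X.rel i).Nonempty) →
    BLPAIPAccepts X A → HomTo X B

/-- The structure whose only relation is the `k`-ary relation `R`. -/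
def single {k : ℕ} (R : Set (Fin k → D)) : RelStr (fun _ : Fin 1 => k) D :=
  ⟨fun _ => R⟩

/-- The Hamming weight of a Boolean tuple. -/
def weight {k : ℕ} (x : Fin k → Bool) : ℕ :=
  (Finset.univ.filter fun i => x i = true).card

/-- The relation of all Boolean `k`-tuples of weight `t`. -/
def tInK (t k : ℕ) : Set (Fin k → Bool) :=
  {x | weight x = t}

/-- The relation of all Boolean `k`-tuples except the two constant ones. -/
def NAE (k : ℕ) : Set (Fin k → Bool) :=
  {x | x ≠ (fun _ => false) ∧ x ≠ (fun _ => true)}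

end PromiseCSP

namespace PromiseCSP

/-! When all weights are odd and `k` is even, reduce an integer solution mod 2: the values on each
instance tuple have odd sum, whereas a constant parity pattern of even length has even sum.
Otherwise a cyclic instance fools BLP+AIP. Differences of weight-`t` tuples generate all zero-sum
vectors, so the affine integer span of `R` is cut out by one congruence, coordinate sum ≡ `t` mod
`d`, where `d` generates the coordinate sums of `diffLattice R`. Take the instance on `ZMod d` with
tuples of sum `t`. Integer representatives satisfy the congruence, which gives the AIP solution; a
positive weighting of `R` with equal marginals (`exists_pos_weighting`) gives an interior BLP point
with no zeros, so the refinement is vacuous. By `exists_monochromatic_zmod` every 2-colouring of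
`ZMod d` has a monochromatic tuple of sum `t`, so there is no homomorphism to NAE. -/

/-- The `0/1` integer vector of a Boolean tuple. -/
def boolVec {k : ℕ} (a : Fin k → Bool) (j : Fin k) : ℤ := if a j = true then 1 else 0

theorem sum_boolVec {k : ℕ} (a : Fin k → Bool) : ∑ j, boolVec a j = weight a := by
  simp [boolVec, weight]

theorem weight_comp_equiv {k : ℕ} (a : Fin k → Bool) (σ : Equiv.Perm (Fin k)) :
    weight (a ∘ σ) = weight a := by
  have h : ∑ j, boolVec (a ∘ σ) j = ∑ j, boolVec a j := Equiv.sum_comp σ (boolVec a)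
  rw [sum_boolVec, sum_boolVec] at h
  exact_mod_cast h

/-! ### The difference lattice -/

/-- The integer combinations of the tuples of `R` whose coefficients sum to zero. -/
def diffLattice {k : ℕ} (R : Set (Fin k → Bool)) : AddSubgroup (Fin k → ℤ) where
  carrier := {z | ∃ u : (Fin k → Bool) → ℤ, (∀ a, a ∉ R → u a = 0) ∧ ∑ a, u a = 0 ∧
    ∀ j, ∑ a, u a * boolVec a j = z j}
  zero_mem' := ⟨0, by simp⟩
  add_mem' := by
    rintro y z ⟨u, hu, hu0, huy⟩ ⟨v, hv, hv0, hvz⟩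
    refine ⟨u + v, fun a ha => by simp [hu a ha, hv a ha], ?_, fun j => ?_⟩
    · simp [Finset.sum_add_distrib, hu0, hv0]
    · simp [add_mul, Finset.sum_add_distrib, huy, hvz]
  neg_mem' := by
    rintro y ⟨u, hu, hu0, huy⟩
    exact ⟨-u, fun a ha => by simp [hu a ha], by simp [hu0], fun j => by simp [huy]⟩

theorem mem_diffLattice {k : ℕ} {R : Set (Fin k → Bool)} {z : Fin k → ℤ} :
    z ∈ diffLattice R ↔ ∃ u : (Fin k → Bool) → ℤ, (∀ a, a ∉ R → u a = 0) ∧ ∑ a, u a = 0 ∧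
      ∀ j, ∑ a, u a * boolVec a j = z j := Iff.rfl

theorem diffLattice_mono {k : ℕ} {R R' : Set (Fin k → Bool)} (h : R ⊆ R') :
    diffLattice R ≤ diffLattice R' := by
  rintro z ⟨u, hu, hz⟩
  exact ⟨u, fun a ha => hu a fun hR => ha (h hR), hz⟩

theorem sub_mem_diffLattice {k : ℕ} {R : Set (Fin k → Bool)} {a b : Fin k → Bool}
    (ha : a ∈ R) (hb : b ∈ R) : boolVec a - boolVec b ∈ diffLattice R := by
  refine ⟨Pi.single a 1 - Pi.single b 1, fun c hc => ?_, ?_, fun j => ?_⟩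
  · have h1 : c ≠ a := fun h => hc (h ▸ ha)
    have h2 : c ≠ b := fun h => hc (h ▸ hb)
    simp [h1, h2]
  · simp
  · simp [sub_mul, Pi.single_apply]

theorem exists_tInK_of_ne {t k : ℕ} (ht : 1 ≤ t) (htk : t < k) {i j : Fin k} (hij : i ≠ j) :
    ∃ a ∈ tInK t k, a i = true ∧ a j = false := by
  obtain ⟨s, h1, h2, h3⟩ := Finset.exists_subsuperset_card_eq
    (s := {i}) (t := Finset.univ.erase j) (n := t) (by simpa using hij) (by simpa using ht)
    (by rw [Finset.card_erase_of_mem (Finset.mem_univ j)]; simp; omega)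
  refine ⟨fun l => decide (l ∈ s), ?_, ?_, ?_⟩
  · simp [tInK, weight, h3]
  · simpa using h1
  · simpa using fun h => Finset.notMem_erase j _ (h2 h)

/-- Swapping a 1 at `i` with a 0 at `j` preserves the weight and changes the tuple by exactly this
vector. -/
theorem single_sub_single_mem {t k : ℕ} (ht : 1 ≤ t) (htk : t < k) (i j : Fin k) :
    (Pi.single i 1 - Pi.single j 1 : Fin k → ℤ) ∈ diffLattice (tInK t k) := by
  rcases eq_or_ne i j with rfl | hij
  · simp [zero_mem]
  obtain ⟨a, ha, hai, haj⟩ := exists_tInK_of_ne ht htk hij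
  have hb : a ∘ Equiv.swap i j ∈ tInK t k := by
    simpa [tInK, weight_comp_equiv] using ha
  convert sub_mem_diffLattice ha hb using 1
  ext l
  rcases eq_or_ne l i with rfl | hli
  · simp [boolVec, hai, haj, hij]
  rcases eq_or_ne l j with rfl | hlj
  · simp [boolVec, hai, haj, hli]
  · simp [boolVec, hli, hlj, Equiv.swap_apply_of_ne_of_ne hli hlj]

theorem mem_diffLattice_of_sum_eq_zero {t k : ℕ} (ht : 1 ≤ t) (htk : t < k) {z : Fin k → ℤ}
    (hz : ∑ j, z j = 0) : z ∈ diffLattice (tInK t k) := by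
  let o : Fin k := ⟨0, by omega⟩
  have h : z = ∑ i, z i • (Pi.single i 1 - Pi.single o 1 : Fin k → ℤ) := by
    ext l
    simp [mul_sub, Finset.sum_apply, Finset.sum_sub_distrib, hz,
      Pi.single_apply]
  rw [h]
  exact sum_mem fun i _ => zsmul_mem (single_sub_single_mem ht htk i o) _

/-- Every integer vector whose coordinate sum is congruent to `t` is an affine integer combination
of `R`. -/
theorem exists_affine_combination {t k : ℕ} (ht : 1 ≤ t) (htk : t < k) {R : Set (Fin k → Bool)}
    (hR : tInK t k ⊆ R) {z : Fin k → ℤ} {y : Fin k → ℤ} (hy : y ∈ diffLattice R)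
    (hz : ∑ j, z j - t = ∑ j, y j) :
    ∃ u : (Fin k → Bool) → ℤ, (∀ a, a ∉ R → u a = 0) ∧ ∑ a, u a = 1 ∧
      ∀ j, ∑ a, u a * boolVec a j = z j := by
  obtain ⟨a, ha, -⟩ := exists_tInK_of_ne (i := ⟨0, by omega⟩) (j := ⟨1, by omega⟩) ht htk (by simp)
  -- The vector `y` absorbs the excess of the coordinate sum over `t`, leaving a zero-sum vector.
  have h0 : z - boolVec a - y ∈ diffLattice (tInK t k) := by
    apply mem_diffLattice_of_sum_eq_zero ht htk
    have hw : weight a = t := ha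
    simp [Finset.sum_sub_distrib, sum_boolVec, hw, hz]
  have h1 : z - boolVec a ∈ diffLattice R := by
    simpa using add_mem (diffLattice_mono hR h0) hy
  obtain ⟨u, hu, hu0, huz⟩ := mem_diffLattice.1 h1
  refine ⟨u + Pi.single a 1, fun c hc => ?_, ?_, fun j => ?_⟩
  · have h2 : c ≠ a := fun h => hc (h ▸ hR ha)
    simp [hu c hc, h2]
  · simp [Finset.sum_add_distrib, hu0]
  · simp [add_mul, Finset.sum_add_distrib, huz, Pi.single_apply]

/-! ### Positive weightings with equal marginals -/

open Classical in
theorem sum_tInK_boolVec_eq (t k : ℕ) (i j : Fin k) :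
    ∑ a with a ∈ tInK t k, boolVec a i = ∑ a with a ∈ tInK t k, boolVec a j := by
  refine Finset.sum_equiv ((Equiv.swap i j).arrowCongr (Equiv.refl Bool)) (fun a => ?_)
    (fun a _ => ?_)
  · have := weight_comp_equiv a (Equiv.swap i j)
    simp only [Finset.mem_filter, Finset.mem_univ, true_and]
    change weight a = t ↔ weight (a ∘ Equiv.swap i j) = t
    rw [this]
  · simp [boolVec, Equiv.arrowCongr]

open Classical in
/-- There is a positive weighting of `R` all of whose marginals agree. -/
theorem exists_pos_weighting {t k : ℕ} (ht : 1 ≤ t) (htk : t < k) {R : Set (Fin k → Bool)}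
    (hR : tInK t k ⊆ R) :
    ∃ (g : (Fin k → Bool) → ℤ) (m : ℤ), (∀ a ∈ R, 0 < g a) ∧ (∀ a, a ∉ R → g a = 0) ∧
      ∀ j, ∑ a, g a * boolVec a j = m := by
  set S : Set (Fin k → Bool) := R \ tInK t k with hSdef
  set y : Fin k → ℤ := fun j => ∑ a with a ∈ S, boolVec a j with hy
  set W : ℤ := ∑ j, y j with hW
  -- With weight `k` on each tuple of `S`, the marginals exceed their mean `W` by this zero-sum
  -- vector, so weight-`t` tuples can cancel it. Adding `M` to every weight-`t` tuple then restores
  -- positivity and, by symmetry, keeps the marginals equal.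
  have hz : (fun j => k * y j - W) ∈ diffLattice (tInK t k) := by
    apply mem_diffLattice_of_sum_eq_zero ht htk
    simp [Finset.sum_sub_distrib, ← Finset.mul_sum, ← hW]
  obtain ⟨u, hu, -, huz⟩ := mem_diffLattice.1 hz
  set M : ℤ := 1 + ∑ a, |u a| with hM
  let o : Fin k := ⟨0, by omega⟩
  refine ⟨fun a => (if a ∈ S then (k : ℤ) else 0) - u a + if a ∈ tInK t k then M else 0,
    W + M * ∑ a with a ∈ tInK t k, boolVec a o, fun a ha => ?_, fun a ha => ?_, fun j => ?_⟩
  · by_cases hat : a ∈ tInK t k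
    · have h1 : u a ≤ |u a| := le_abs_self _
      have h2 : |u a| ≤ ∑ a, |u a| :=
        Finset.single_le_sum (f := fun a => |u a|) (fun _ _ => abs_nonneg _) (Finset.mem_univ a)
      simp only [hSdef, Set.mem_sdiff, hat, not_true_eq_false, and_false, if_false, if_true]
      linarith
    · have : (0 : ℤ) < k := by omega
      simpa [hSdef, ha, hat, hu a hat] using this
  · have hat : a ∉ tInK t k := fun h => ha (hR h)
    simp [hSdef, ha, hat, hu a hat]
  · have h := huz j
    simp only [add_mul, sub_mul, ite_mul, zero_mul, Finset.sum_add_distrib,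
      Finset.sum_sub_distrib, h, ← Finset.sum_filter, ← Finset.mul_sum,
      sum_tInK_boolVec_eq t k o j]
    simp only [hy, Finset.mul_sum, Finset.sum_filter, mul_ite, mul_zero]
    ring

/-! ### Solutions of the relaxations -/

section Relaxation

variable {D V : Type} {p : ℕ} {ar : Fin p → ℕ}

/-- The solutions of the relaxation equations form an affine subspace. -/
def relaxSubspace [Fintype D] (X : RelStr ar V) (A : RelStr ar D) :
    AffineSubspace ℝ (RelaxVars X A ℝ) where
  carrier := {v | RelaxEqs X A v}
  smul_vsub_vadd_mem' := by
    rintro c u v w ⟨hu1, hu2, hu3⟩ ⟨hv1, hv2, hv3⟩ ⟨hw1, hw2, hw3⟩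
    refine ⟨fun i x => ?_, fun x => ?_, fun i x b j => ?_⟩
    · simp [Finset.sum_add_distrib, ← Finset.mul_sum, Finset.sum_sub_distrib, hu1, hv1, hw1]
    · simp [Finset.sum_add_distrib, ← Finset.mul_sum, Finset.sum_sub_distrib, hu2, hv2, hw2]
    · simp [Finset.sum_add_distrib, ← Finset.mul_sum, Finset.sum_sub_distrib, hu3, hv3, hw3]

theorem mem_BLP_of_pos [Fintype D] {X : RelStr ar V} {A : RelStr ar D} {v : RelaxVars X A ℝ}
    (h1 : ∀ i x a, 0 < v.1 i x a) (h2 : ∀ x a, 0 < v.2 x a) (h : RelaxEqs X A v) :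
    v ∈ BLP X A := by
  classical
  refine ⟨fun i x a => ⟨(h1 i x a).le, ?_⟩, fun x a => ⟨(h2 x a).le, ?_⟩, h⟩
  · rw [← h.1 i x]
    exact Finset.single_le_sum (f := v.1 i x) (fun b _ => (h1 i x b).le) (Finset.mem_univ a)
  · rw [← h.2.1 x]
    exact Finset.single_le_sum (f := v.2 x) (fun b _ => (h2 x b).le) (Finset.mem_univ a)

/-- A strictly positive solution of the relaxation equations is a relative interior point. -/
theorem mem_intrinsicInterior_BLP_of_pos [Finite V] [Fintype D] {X : RelStr ar V}
    {A : RelStr ar D} {v : RelaxVars X A ℝ}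
    (h1 : ∀ i x a, 0 < v.1 i x a) (h2 : ∀ x a, 0 < v.2 x a) (h : RelaxEqs X A v) :
    v ∈ intrinsicInterior ℝ (BLP X A) := by
  have hv := mem_BLP_of_pos h1 h2 h
  rw [mem_intrinsicInterior]
  refine ⟨⟨v, subset_affineSpan ℝ _ hv⟩, ?_, rfl⟩
  set U : Set (RelaxVars X A ℝ) := {w | (∀ i x a, 0 < w.1 i x a) ∧ ∀ x a, 0 < w.2 x a} with hU
  have hUo : IsOpen U := by
    have e : U = (⋂ i, ⋂ x, ⋂ a, {w | 0 < w.1 i x a}) ∩ ⋂ x, ⋂ a, {w | 0 < w.2 x a} := by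
      ext w; simp [hU]
    rw [e]
    refine IsOpen.inter ?_ ?_
    · exact isOpen_iInter_of_finite fun i => isOpen_iInter_of_finite fun x =>
        isOpen_iInter_of_finite fun a => isOpen_lt continuous_const (by fun_prop)
    · exact isOpen_iInter_of_finite fun x =>
        isOpen_iInter_of_finite fun a => isOpen_lt continuous_const (by fun_prop)
  rw [mem_interior]
  -- The equations persist on the affine span, and positivity, an open condition, then implies all
  -- the bounds.
  refine ⟨Subtype.val ⁻¹' U, ?_, hUo.preimage continuous_subtype_val, ⟨h1, h2⟩⟩
  rintro ⟨w, hw⟩ ⟨hw1, hw2⟩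
  have hle : affineSpan ℝ (BLP X A) ≤ relaxSubspace X A :=
    affineSpan_le.2 fun w hw => hw.2.2
  exact mem_BLP_of_pos hw1 hw2 (hle hw)

end Relaxation

open Classical in
theorem relaxEqs_single {k : ℕ} {V K : Type} [CommRing K] {T : Set (Fin k → V)}
    {R : Set (Fin k → Bool)} (u : T → (Fin k → Bool) → K) (z : V → K)
    (hu : ∀ x a, a ∉ R → u x a = 0) (h1 : ∀ x, ∑ a, u x a = 1)
    (h2 : ∀ (x : T) (j : Fin k), ∑ a with a j = true, u x a = z (x.1 j)) :
    RelaxEqs (single T) (single R)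
      ((fun _ x a => u x a.1, fun x b => if b = true then z x else 1 - z x) :
        RelaxVars (single T) (single R) K) := by
  have key : ∀ (x : T) (q : (Fin k → Bool) → Prop),
      ∑ a : R with q a.1, u x a.1 = ∑ a with q a, u x a := by
    intro x q
    rw [Finset.sum_filter, Finset.sum_filter,
      ← Finset.sum_filter_of_ne (p := (· ∈ R)) (s := Finset.univ)
        (f := fun a => if q a then u x a else 0)
        (fun a _ ha => by by_contra hR; simp [hu x a hR] at ha)]
    exact (Finset.sum_subtype _ (p := (· ∈ R)) (by simp) fun a => if q a then u x a else 0).symm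
  have h3 : ∀ (x : T) (j : Fin k), ∑ a with a j = false, u x a = 1 - z (x.1 j) := by
    intro x j
    have h := Finset.sum_filter_add_sum_filter_not Finset.univ
      (fun a : Fin k → Bool => a j = true) (u x)
    rw [h1, h2] at h
    simpa using eq_sub_of_add_eq' h
  refine ⟨fun i x => ?_, fun x => by simp, fun i x b j => ?_⟩
  · have h := key x fun _ => True
    simp only [Finset.filter_true, h1 x] at h
    exact h
  · have h := key x fun a => a j = b
    refine Eq.trans h ?_
    cases b
    · exact (Finset.sum_congr (by ext; simp) fun _ _ => rfl).trans ((h3 x j).trans (by simp))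
    · exact (Finset.sum_congr (by ext; simp) fun _ _ => rfl).trans ((h2 x j).trans (by simp))

/-! ### Monochromatic tuples in cyclic groups -/

/-- If a map sends `a` and `b` to the same value, it is constant on a tuple with the given sum. -/
theorem exists_monochromatic {k : ℕ} {G : Type} [AddCommGroup G] (f : G → Bool) {a b : G}
    (hf : f a = f b) {j : ℕ} (hj : j ≤ k) :
    ∃ x : Fin k → G, ∑ i, x i = k • a + j • (b - a) ∧ ∀ i, f (x i) = f a := by
  refine ⟨fun i => a + if i.1 < j then b - a else 0, ?_, fun i => ?_⟩
  · have hc : (Finset.univ.filter fun i : Fin k => i.1 < j).card = j := by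
      rw [Fin.card_filter_val_lt]; omega
    simp [Finset.sum_add_distrib, ← Finset.sum_filter, hc, smul_sub]
  · dsimp only
    split_ifs <;> simp [hf]

theorem exists_monochromatic_zmod {k t d : ℕ} [NeZero d] (hd : d ≤ k) (htk : t < k)
    (h : ¬ (Odd t ∧ Even k) ∨ ∃ w : ℕ, Even w ∧ w ≤ k ∧ (w : ZMod d) = t) (f : ZMod d → Bool) :
    ∃ x : Fin k → ZMod d, ∑ i, x i = t ∧ ∃ c, ∀ i, f (x i) = c := by
  by_cases hA : ∃ a, f a = f (a + 1)
  · obtain ⟨a, ha⟩ := hA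
    obtain ⟨x, hx, hc⟩ := exists_monochromatic f ha
      (((ZMod.val_lt ((t : ZMod d) - k • a)).le.trans hd))
    refine ⟨x, ?_, _, hc⟩
    rw [hx]
    simp
  · push Not at hA
    have h2 : ∀ a, f a = f (a + 2) := by
      intro a
      have h1 := hA a
      have h3 := hA (a + 1)
      rw [add_assoc, one_add_one_eq_two] at h3
      cases h4 : f a <;> cases h5 : f (a + 1) <;> cases h6 : f (a + 2) <;> simp_all
    have even_case : ∀ w : ℕ, Even w → w ≤ k → (w : ZMod d) = t →
        ∃ x : Fin k → ZMod d, ∑ i, x i = t ∧ ∃ c, ∀ i, f (x i) = c := by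
      rintro w ⟨j, rfl⟩ hw hwt
      obtain ⟨x, hx, hc⟩ := exists_monochromatic (k := k) (j := j) f (h2 0) (by omega)
      refine ⟨x, ?_, _, hc⟩
      rw [hx, ← hwt]
      push_cast
      simp [mul_two]
    rcases h with h | ⟨w, hw, hwk, hwt⟩
    · rcases Nat.even_or_odd t with hte | hto
      · exact even_case t hte htk.le rfl
      · obtain ⟨j, hj⟩ : Even (k - t) :=
          Nat.Odd.sub_odd (Nat.not_even_iff_odd.1 fun hk => h ⟨hto, hk⟩) hto
        obtain ⟨x, hx, hc⟩ := exists_monochromatic (k := k) (j := j) f (a := 1) (b := -1)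
          (by rw [h2 (-1)]; congr 1; ring) (by omega)
        refine ⟨x, ?_, _, hc⟩
        have hk : k = t + (j + j) := by omega
        rw [hx, hk]
        simp only [nsmul_eq_mul]
        push_cast
        ring
    · exact even_case w hw hwk hwt

/-- The instance on `ZMod d` whose tuples are those with sum `t` is accepted by BLP+AIP. -/
theorem BLPAIPAccepts_zmod {t k d : ℕ} [NeZero d] (ht : 1 ≤ t) (htk : t < k)
    {R : Set (Fin k → Bool)} (hR : tInK t k ⊆ R)
    (hd : ∃ y ∈ diffLattice R, ∑ j, y j = d) :
    BLPAIPAccepts (single {x : Fin k → ZMod d | ∑ i, x i = t}) (single R) := by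
  classical
  obtain ⟨g, m, hg, hg0, hgm⟩ := exists_pos_weighting ht htk hR
  obtain ⟨a, ha, ha0, ha1⟩ :=
    exists_tInK_of_ne (i := ⟨0, by omega⟩) (j := ⟨1, by omega⟩) ht htk (by simp)
  have hgn : ∀ a, 0 ≤ g a := fun a => by
    by_cases h : a ∈ R
    · exact (hg a h).le
    · exact (hg0 a h).ge
  have hm : 0 < m := by
    rw [← hgm ⟨0, by omega⟩]
    refine Finset.sum_pos' (fun b _ => mul_nonneg (hgn b) ?_) ⟨a, Finset.mem_univ _, ?_⟩
    · unfold boolVec; split_ifs <;> simp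
    · simpa [boolVec, ha0] using hg a (hR ha)
  have hmG : m < ∑ a, g a := by
    rw [← hgm ⟨1, by omega⟩]
    refine Finset.sum_lt_sum (fun b _ => ?_) ⟨a, Finset.mem_univ _, ?_⟩
    · unfold boolVec; split_ifs <;> simp [hgn b]
    · simpa [boolVec, ha1] using hg a (hR ha)
  set G : ℤ := ∑ a, g a with hG
  have hG0 : (0 : ℝ) < G := by exact_mod_cast hm.trans hmG
  have hm' : (0 : ℝ) < m := by exact_mod_cast hm
  have hmG' : (m : ℝ) < G := by exact_mod_cast hmG
  refine ⟨_, mem_intrinsicInterior_BLP_of_pos (fun i x a => ?_) (fun x b => ?_)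
    (relaxEqs_single (fun _ a => (g a : ℝ) / G) (fun _ => (m : ℝ) / G) (fun _ a ha => ?_)
      (fun _ => ?_) (fun _ j => ?_)), ?_⟩
  · have := hg a.1 a.2
    positivity
  · have h1 : (m : ℝ) / G < 1 := (div_lt_one hG0).2 hmG'
    cases b
    · simpa using h1
    · simp only [if_true]; positivity
  · simp [hg0 a ha]
  · rw [← Finset.sum_div, hG]
    push_cast
    rw [hG] at hG0
    push_cast at hG0
    exact div_self hG0.ne'
  · rw [← Finset.sum_div, ← hgm j]
    congr 1
    simp [boolVec, Finset.sum_filter]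
  obtain ⟨y, hy, hyd⟩ := hd
  have hτ : ∀ x : {x : Fin k → ZMod d | ∑ i, x i = t}, ∃ u : (Fin k → Bool) → ℤ,
      (∀ a, a ∉ R → u a = 0) ∧ ∑ a, u a = 1 ∧ ∀ j, ∑ a, u a * boolVec a j = (x.1 j).val := by
    intro x
    have h1 : (d : ℤ) ∣ ∑ j, ((x.1 j).val : ℤ) - t := by
      rw [← ZMod.intCast_zmod_eq_zero_iff_dvd]
      have := x.2
      simp only [Set.mem_ofPred_eq] at this
      simp [this]
    obtain ⟨c, hc⟩ := h1
    refine exists_affine_combination ht htk hR (zsmul_mem hy c) ?_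
    rw [hc, ← hyd]
    simp [← Finset.mul_sum, mul_comm]
  choose u hu0 hu1 hu using hτ
  refine ⟨_, relaxEqs_single u (fun x => (x.val : ℤ)) hu0 hu1 fun x j => ?_, fun i x a h => ?_,
    fun x b h => ?_⟩
  · rw [← hu x j]
    simp [boolVec, Finset.sum_filter]
  · have := hg a.1 a.2
    have : (0 : ℝ) < g a.1 / G := by positivity
    exact absurd h this.ne'
  · have h1 : (m : ℝ) / G < 1 := (div_lt_one hG0).2 hmG'
    have h2 : (0 : ℝ) < m / G := by positivity
    cases b
    · simp only [Bool.false_eq_true, if_false] at h; linarith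
    · simp only [if_true] at h; linarith

theorem not_homTo_NAE_zmod {t k d : ℕ} [NeZero d] (hd : d ≤ k) (htk : t < k)
    (h : ¬ (Odd t ∧ Even k) ∨ ∃ w : ℕ, Even w ∧ w ≤ k ∧ (w : ZMod d) = t) :
    ¬ HomTo (single {x : Fin k → ZMod d | ∑ i, x i = t}) (single (NAE k)) := by
  rintro ⟨f, hf⟩
  obtain ⟨x, hx, c, hc⟩ := exists_monochromatic_zmod hd htk h f
  obtain ⟨h0, h1⟩ := hf 0 x hx
  cases c
  · exact h0 (funext hc)
  · exact h1 (funext hc)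

open Classical in
/-- If every tuple of `R` has odd weight and the arity is even, the parities of an integer solution
form a homomorphism to `NAE`. -/
theorem AIPSolves_of_odd_weight {k : ℕ} (hk : Even k) {R : Set (Fin k → Bool)}
    (hR : ∀ a ∈ R, Odd (weight a)) : AIPSolves (single R) (single (NAE k)) := by
  rintro V _ X - ⟨τ, h1, -, h3⟩
  refine ⟨fun x => decide (Odd (τ.2 x true)), fun i x hx => ?_⟩
  obtain ⟨u, hu1, hu⟩ : ∃ u : R → ℤ, ∑ a, u a = 1 ∧
      ∀ j, ∑ a : R, u a * boolVec a.1 j = τ.2 (x j) true := by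
    refine ⟨τ.1 i ⟨x, hx⟩, h1 i ⟨x, hx⟩, fun j => ?_⟩
    rw [← h3 i ⟨x, hx⟩ true j, Finset.sum_filter]
    refine Finset.sum_congr rfl fun a _ => ?_
    simp [boolVec]
  have hsum : ∑ j, τ.2 (x j) true = ∑ a : R, u a * weight a.1 := by
    simp_rw [← hu, ← sum_boolVec, Finset.mul_sum]
    exact Finset.sum_comm
  have hodd : Odd (∑ j, τ.2 (x j) true) := by
    have h : Even (∑ j, τ.2 (x j) true - 1) := by
      rw [hsum, ← hu1, ← Finset.sum_sub_distrib]
      refine Finset.even_sum _ fun a _ => ?_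
      obtain ⟨n, hn⟩ := hR a.1 a.2
      rw [hn]
      exact ⟨u a * n, by push_cast; ring⟩
    simpa using h.add_one
  refine ⟨fun hc => ?_, fun hc => ?_⟩
  · refine Int.not_even_iff_odd.2 hodd (Finset.even_sum _ fun j _ => ?_)
    simpa using congrFun hc j
  · refine Int.not_even_iff_odd.2 hodd ?_
    have : Even (∑ j, (τ.2 (x j) true - 1)) := by
      refine Finset.even_sum _ fun j _ => ?_
      have : Odd (τ.2 (x j) true) := by simpa using congrFun hc j
      exact this.sub_odd odd_one
    rw [Finset.sum_sub_distrib] at this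
    have h2 : Even (∑ _j : Fin k, (1 : ℤ)) := by simpa using hk
    simpa using this.add h2

theorem weight_le {k : ℕ} (a : Fin k → Bool) : weight a ≤ k :=
  (Finset.card_le_univ _).trans (by simp)

end PromiseCSP

theorem theorem3p1 (k t : ℕ) (hk : 3 ≤ k) (ht : 1 ≤ t) (htk : t < k)
    (S : Set (Fin k → Bool)) (hne : S.Nonempty)
    (hS : S ⊆ (PromiseCSP.tInK t k)ᶜ ∩ PromiseCSP.NAE k) :
    ((Odd t ∧ Even k ∧ ∀ x ∈ S, Odd (PromiseCSP.weight x)) →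
      PromiseCSP.AIPSolves (PromiseCSP.single (PromiseCSP.tInK t k ∪ S))
        (PromiseCSP.single (PromiseCSP.NAE k))) ∧
    (¬ (Odd t ∧ Even k ∧ ∀ x ∈ S, Odd (PromiseCSP.weight x)) →
      ¬ PromiseCSP.BLPAIPSolves (PromiseCSP.single (PromiseCSP.tInK t k ∪ S))
        (PromiseCSP.single (PromiseCSP.NAE k))) := by
  open PromiseCSP in
  constructor
  · rintro ⟨hto, hke, hSo⟩
    refine AIPSolves_of_odd_weight hke ?_
    rintro a (ha | ha)
    · have : weight a = t := ha
      rwa [this]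
    · exact hSo a ha
  intro hcase hsol
  set R := tInK t k ∪ S with hR
  have hRt : tInK t k ⊆ R := Set.subset_union_left
  let sumHom : (Fin k → ℤ) →+ ℤ :=
    { toFun := fun z => ∑ j, z j
      map_zero' := by simp
      map_add' := fun y z => by simp [Finset.sum_add_distrib] }
  obtain ⟨e, he⟩ := Int.subgroup_cyclic ((diffLattice R).map sumHom)
  have hdvd : ∀ s ∈ S, (e.natAbs : ℤ) ∣ weight s - t := by
    intro s hs
    obtain ⟨a, ha, -⟩ :=
      exists_tInK_of_ne (i := ⟨0, by omega⟩) (j := ⟨1, by omega⟩) ht htk (by simp)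
    have h1 : (weight s - t : ℤ) ∈ (diffLattice R).map sumHom := by
      refine ⟨_, sub_mem_diffLattice (Or.inr hs) (hRt ha), ?_⟩
      have hw : weight a = t := ha
      simp [sumHom, Finset.sum_sub_distrib, sum_boolVec, hw]
    rw [he, AddSubgroup.mem_closure_singleton] at h1
    obtain ⟨c, hc⟩ := h1
    rw [Int.natAbs_dvd]
    exact ⟨c, by rw [← hc]; simp [mul_comm]⟩
  have hd : ∃ y ∈ diffLattice R, ∑ j, y j = (e.natAbs : ℤ) := by
    have : (e.natAbs : ℤ) ∈ (diffLattice R).map sumHom := by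
      rw [he, AddSubgroup.mem_closure_singleton]
      rcases Int.natAbs_eq e with h | h
      · exact ⟨1, by simpa using h⟩
      · exact ⟨-1, by rw [neg_one_zsmul]; omega⟩
    exact this
  generalize e.natAbs = d at hdvd hd
  obtain ⟨s, hs⟩ := hne
  have hst : weight s ≠ t := (hS hs).1
  have hdk : d ≠ 0 ∧ d ≤ k := by
    have h1 := hdvd s hs
    have h2 := weight_le s
    constructor
    · rintro rfl
      rw [Nat.cast_zero, zero_dvd_iff] at h1
      omega
    · have h3 := Int.le_of_dvd (a := d) (b := |(weight s : ℤ) - t|)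
        (abs_pos.2 (by omega)) ((dvd_abs _ _).2 h1)
      have h4 : |(weight s : ℤ) - t| ≤ k := abs_le.2 ⟨by omega, by omega⟩
      omega
  have : NeZero d := ⟨hdk.1⟩
  refine not_homTo_NAE_zmod (d := d) hdk.2 htk ?_ (hsol (ZMod d) _ (fun _ => ?_)
    (BLPAIPAccepts_zmod ht htk hRt hd))
  · by_contra! hcon
    refine hcase ⟨hcon.1.1, hcon.1.2, fun s hs => ?_⟩
    by_contra hodd
    refine hcon.2 (weight s) (Nat.not_odd_iff_even.1 hodd) (weight_le s) ?_
    have h1 := (ZMod.intCast_zmod_eq_zero_iff_dvd _ d).2 (hdvd s hs)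
    push_cast at h1
    exact sub_eq_zero.1 h1
  · exact ⟨Pi.single (⟨0, by omega⟩ : Fin k) (t : ZMod d), by simp [single]⟩
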